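/- **Setting.** Let $\mathbf A=[a_{ij}]\in\mathbb R^{N\times N}$ be the adjacency matrix of a weighted undirected connected network ($a_{ij}=a_{ji}\ge 0$, and $a_{ij}\neq 0$ indicates an edge), let $c>0$, $\mathbf H\in\mathbb R^{n\times n}$, $\mathbf f:\mathbb R^n\to\mathbb R^n$, and consider $$\dot{\mathbf x}_i=\mathbf f(\mathbf x_i)+c\sum_{j=1}^N a_{ij}\mathbf H(\mathbf x_j-\mathbf x_i)+\mathbf u_i,\qquad \mathbf u_i=-\zeta_i g_i\mathbf H(\mathbf x_i-\mathbf s),\qquad i=1,\dots,N,$$ where $\mathbf s$ is a reference trajectory, $\dot{\mathbf s}=\mathbf f(\mathbf s)$, and $\zeta_i\in\{0,1\}$, $g_i\in\mathbb R$; put $\mathbf Z=\mathrm{diag}(\zeta_1,\dots,\zeta_N)$ and $\mathbf G=\mathrm{diag}(g_1,\dots,g_N)$. Suppose that $\Omega\subseteq\mathbb R^n$ and a symmetric positive semidefinite matrix $\mathbf F$ satisfy $$(\mathbf x-\mathbf y)^T[\mathbf f(\mathbf x)-\mathbf f(\mathbf y)]\le(\mathbf x-\mathbf y)^T\mathbf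 F(\mathbf x-\mathbf y)\qquad\text{for all }\mathbf x,\mathbf y\in\Omega .$$ Let $\mathbf e=(\mathbf x_1-\mathbf s,\dots,\mathbf x_N-\mathbf s)\in\mathbb R^{Nn}$. The pair $(\mathbf Z,\mathbf G)$ is said to guarantee a convergence rate of at least $\alpha$ if there is a constant $C$ such that $$\|\mathbf e(t)\|\le C e^{-\alpha(t-t_0)}\|\mathbf e(t_0)\|$$ for every initial time $t_0$, every reference trajectory $\mathbf s$ and every solution $(\mathbf x_1,\dots,\mathbf x_N)$ of the closed loop on a time interval with first point $t_0$ (in particular on $[t_0,\infty)$) along which $\mathbf s$ and all $\mathbf x_i$ stay in $\Omega$, and for all $t$ in that interval. **Proposition.** Let $\mathbf H$ be positive definite, that is, $\mathbf v^T\mathbf H\mathbf v>0$ for all $\mathbf v\ne 0$ ($\mathbf H$ need not be symmetric), and let $\mathbf H^{(s)}=\tfrac12(\mathbf H+\mathbf H^T)$ be its symmetric part. Then for every desired convergence rate $\alpha>0$ there is a pinning pair $(\mathbf Z,\mathbf G)$ that guarantees a convergence rate of at least $\alpha$. Indeed, one may pin all nodes, $\mathbf Z=\mathbf I_N$, with the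 gain matrix $$\mathbf G=\frac{\alpha+\lambda_{\max}(\mathbf F)}{\lambda_{\min}(\mathbf H^{(s)})}\,\mathbf I_N,$$ where $\mathbf H^{(s)}=\mathbf H$ if $\mathbf H$ is symmetric. -/

import Mathlib

/-- Data of a network of `N` linearly coupled identical systems with states in `ℝⁿ`:
node dynamics `f`, coupling strength `c`, adjacency matrix `A = [a_ij]`, inner coupling `H`. -/
structure Network (N n : ℕ) where
  f : EuclideanSpace ℝ (Fin n) → EuclideanSpace ℝ (Fin n)
  c : ℝ
  A : Matrix (Fin N) (Fin N) ℝ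
  H : Matrix (Fin n) (Fin n) ℝ

/-- The weighted network with adjacency matrix `A` is undirected and connected
(edge weights are nonnegative, and `a_ij ≠ 0` indicates an edge). -/
def UndirectedConnected {N : ℕ} (A : Matrix (Fin N) (Fin N) ℝ) : Prop :=
  (∀ i j, 0 ≤ A i j) ∧ (∀ i j, A i j = A j i) ∧
    (SimpleGraph.fromRel (fun i j : Fin N => A i j ≠ 0)).Connected

/-- `(x - y)ᵀ (f x - f y) ≤ (x - y)ᵀ F (x - y)` for all `x, y ∈ Ω`. -/
def QuadBound {n : ℕ} (f : EuclideanSpace ℝ (Fin n) → EuclideanSpace ℝ (Fin n))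
    (Ω : Set (EuclideanSpace ℝ (Fin n))) (F : Matrix (Fin n) (Fin n) ℝ) : Prop :=
  ∀ x ∈ Ω, ∀ y ∈ Ω,
    inner ℝ (x - y) (f x - f y) ≤ inner ℝ (x - y) (Matrix.toEuclideanLin F (x - y))

/-- Positive definiteness `vᵀ M v > 0` for `v ≠ 0` of a real square matrix that need not be
symmetric. -/
def PositiveDefinite {n : ℕ} (M : Matrix (Fin n) (Fin n) ℝ) : Prop :=
  ∀ v : Fin n → ℝ, v ≠ 0 → 0 < v ⬝ᵥ Matrix.mulVec M v

/-- The symmetric part of a real square matrix. -/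
noncomputable def symmetricPart {n : ℕ} (M : Matrix (Fin n) (Fin n) ℝ) :
    Matrix (Fin n) (Fin n) ℝ :=
  (1 / 2 : ℝ) • (M + M.transpose)

/-- The smallest eigenvalue of a real symmetric matrix (the spectrum is then finite, and
nonempty as soon as `n ≥ 1`). -/
noncomputable def lambdaMin {n : ℕ} (M : Matrix (Fin n) (Fin n) ℝ) : ℝ :=
  sInf (spectrum ℝ M)

/-- The largest eigenvalue of a real symmetric matrix. -/
noncomputable def lambdaMax {n : ℕ} (M : Matrix (Fin n) (Fin n) ℝ) : ℝ :=
  sSup (spectrum ℝ M)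

/-- A choice of pinned nodes (`ζ i = 1` iff node `i` is pinned) and of pinning gains. -/
structure PinningPair (N : ℕ) where
  ζ : Fin N → ℝ
  binary : ∀ i, ζ i = 0 ∨ ζ i = 1
  g : Fin N → ℝ

/-- The pinning matrix `Z = diag(ζ₁, …, ζ_N)`. -/
def PinningPair.Z {N : ℕ} (P : PinningPair N) : Matrix (Fin N) (Fin N) ℝ :=
  Matrix.diagonal P.ζ

/-- The pinning gain matrix `G = diag(g₁, …, g_N)`. -/
def PinningPair.G {N : ℕ} (P : PinningPair N) : Matrix (Fin N) (Fin N) ℝ :=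
  Matrix.diagonal P.g

/-- On the time set `T`, the states `x i` solve
`ẋ_i = f(x_i) + c ∑_j a_ij H (x_j - x_i) + u_i` for the inputs `u i`
(one-sided derivatives at the end points of an interval `T`). -/
def Network.IsSolution {N n : ℕ} (S : Network N n) (T : Set ℝ)
    (u x : Fin N → ℝ → EuclideanSpace ℝ (Fin n)) : Prop :=
  ∀ i, ∀ t ∈ T, HasDerivWithinAt (x i)
    (S.f (x i t) + S.c • ∑ j, S.A i j • Matrix.toEuclideanLin S.H (x j t - x i t) + u i t) T t

/-- The linear feedback `u_i = - ζ_i g_i H (x_i - s)`. -/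
noncomputable def Network.feedback {N n : ℕ} (S : Network N n) (P : PinningPair N)
    (s : ℝ → EuclideanSpace ℝ (Fin n)) (x : Fin N → ℝ → EuclideanSpace ℝ (Fin n)) :
    Fin N → ℝ → EuclideanSpace ℝ (Fin n) :=
  fun i t => -((P.ζ i * P.g i) • Matrix.toEuclideanLin S.H (x i t - s t))

/-- The overall tracking error `e = (x_1 - s, …, x_N - s)`, with the Euclidean norm of `ℝ^{Nn}`. -/
def trackingError {N n : ℕ} (s : ℝ → EuclideanSpace ℝ (Fin n))
    (x : Fin N → ℝ → EuclideanSpace ℝ (Fin n)) (t : ℝ) :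
    PiLp 2 (fun _ : Fin N => EuclideanSpace ℝ (Fin n)) :=
  WithLp.toLp 2 (fun i => x i t - s t)

/-- The feedback law with pinning pair `P` guarantees convergence rate at least `α` on `Ω`:
for one constant `C`, each reference trajectory `ṡ = f(s)` and each solution of the closed loop,
on any time interval `T` with initial time `t₀` on which these trajectories stay in `Ω`
(in particular on `[t₀, ∞)`), satisfy `‖e(t)‖ ≤ C exp(-α (t - t₀)) ‖e(t₀)‖` for all `t ∈ T`. -/
def Network.GuaranteesRate {N n : ℕ} (S : Network N n) (Ω : Set (EuclideanSpace ℝ (Fin n)))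
    (P : PinningPair N) (α : ℝ) : Prop :=
  ∃ C : ℝ, ∀ (t₀ : ℝ) (T : Set ℝ), T.OrdConnected → IsLeast T t₀ →
    ∀ (s : ℝ → EuclideanSpace ℝ (Fin n)) (x : Fin N → ℝ → EuclideanSpace ℝ (Fin n)),
      (∀ t ∈ T, s t ∈ Ω ∧ ∀ i, x i t ∈ Ω) →
      (∀ t ∈ T, HasDerivWithinAt s (S.f (s t)) T t) →
      S.IsSolution T (S.feedback P s x) x →
      ∀ t ∈ T, ‖trackingError s x t‖ ≤ C * Real.exp (-α * (t - t₀)) * ‖trackingError s x t₀‖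

/-! The Lyapunov function is `V = ‖e‖²`, whose derivative is twice the sum of the inner products of
each node's error with its error dynamics. Symmetry of the weights makes the total coupling
contribution nonpositive (`sum_inner_coupling_nonpos`). At each node `f` contributes at most
`λ_max(F)‖e_i‖²`, and the gain is chosen so that pinning removes at least `(α + λ_max(F))‖e_i‖²`
(`PositiveDefinite.mul_norm_sq_le`). Hence `V' ≤ -2αV`, and Grönwall's argument gives the rate `α`
with `C = 1`. -/

section QuadraticForms

variable {n : ℕ} {M : Matrix (Fin n) (Fin n) ℝ}

theorem inner_toEuclideanLin_self (M : Matrix (Fin n) (Fin n) ℝ)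
    (v : EuclideanSpace ℝ (Fin n)) :
    inner ℝ v (Matrix.toEuclideanLin M v) = v.ofLp ⬝ᵥ Matrix.mulVec M v.ofLp := by
  rw [EuclideanSpace.inner_eq_star_dotProduct, Matrix.ofLp_toLpLin, Matrix.toLin'_apply,
    star_trivial, dotProduct_comm]

theorem Matrix.PosSemidef.inner_toEuclideanLin_nonneg (hM : M.PosSemidef)
    (v : EuclideanSpace ℝ (Fin n)) : 0 ≤ inner ℝ v (Matrix.toEuclideanLin M v) := by
  rw [inner_toEuclideanLin_self]
  simpa using hM.dotProduct_mulVec_nonneg v.ofLp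

theorem toEuclideanLin_algebraMap (r : ℝ) (v : EuclideanSpace ℝ (Fin n)) :
    Matrix.toEuclideanLin (algebraMap ℝ (Matrix (Fin n) (Fin n) ℝ) r) v = r • v := by
  rw [Algebra.algebraMap_eq_smul_one, map_smul, LinearMap.smul_apply]
  congr 1
  ext i
  simp

theorem isHermitian_algebraMap (r : ℝ) :
    (algebraMap ℝ (Matrix (Fin n) (Fin n) ℝ) r).IsHermitian := by
  rw [Matrix.algebraMap_eq_diagonal]
  exact Matrix.isHermitian_diagonal _

/-- The spectrum of `λ_max • 1 - M` is `λ_max - σ(M)`, which is nonnegative, so this matrix is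
positive semidefinite. -/
theorem Matrix.IsHermitian.inner_toEuclideanLin_le (hM : M.IsHermitian)
    (v : EuclideanSpace ℝ (Fin n)) :
    inner ℝ v (Matrix.toEuclideanLin M v) ≤ lambdaMax M * ‖v‖ ^ 2 := by
  have h : (algebraMap ℝ _ (lambdaMax M) - M).PosSemidef := by
    refine Matrix.posSemidef_iff_isHermitian_and_spectrum_nonneg.2
      ⟨(isHermitian_algebraMap _).sub hM, ?_⟩
    rw [← spectrum.singleton_sub_eq]
    rintro _ ⟨a, rfl, μ, hμ, rfl⟩
    exact sub_nonneg.2 (le_csSup M.finite_real_spectrum.bddAbove hμ)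
  have := h.inner_toEuclideanLin_nonneg v
  rw [map_sub, LinearMap.sub_apply, toEuclideanLin_algebraMap, inner_sub_right,
    real_inner_smul_right, real_inner_self_eq_norm_sq] at this
  linarith

theorem Matrix.IsHermitian.le_inner_toEuclideanLin (hM : M.IsHermitian)
    (v : EuclideanSpace ℝ (Fin n)) :
    lambdaMin M * ‖v‖ ^ 2 ≤ inner ℝ v (Matrix.toEuclideanLin M v) := by
  have h : (M - algebraMap ℝ _ (lambdaMin M)).PosSemidef := by
    refine Matrix.posSemidef_iff_isHermitian_and_spectrum_nonneg.2
      ⟨hM.sub (isHermitian_algebraMap _), ?_⟩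
    rw [← spectrum.sub_singleton_eq]
    rintro _ ⟨μ, hμ, a, rfl, rfl⟩
    exact sub_nonneg.2 (csInf_le M.finite_real_spectrum.bddBelow hμ)
  have := h.inner_toEuclideanLin_nonneg v
  rw [map_sub, LinearMap.sub_apply, toEuclideanLin_algebraMap, inner_sub_right,
    real_inner_smul_right, real_inner_self_eq_norm_sq] at this
  linarith

theorem lambdaMax_nonneg (hM : M.PosSemidef) : 0 ≤ lambdaMax M :=
  Real.sSup_nonneg fun _ hμ =>
    (Matrix.posSemidef_iff_isHermitian_and_spectrum_nonneg.1 hM).2 hμ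

theorem lambdaMin_pos [NeZero n] (hM : M.PosDef) : 0 < lambdaMin M := by
  -- A finite nonempty spectrum attains its infimum; for `n = 0` the value would be `sInf ∅ = 0`.
  have hne : (spectrum ℝ M).Nonempty := ⟨_, hM.1.eigenvalues_mem_spectrum_real 0⟩
  have hmem : lambdaMin M ∈ spectrum ℝ M := hne.csInf_mem M.finite_real_spectrum
  rw [hM.1.spectrum_real_eq_range_eigenvalues] at hmem
  obtain ⟨i, hi⟩ := hmem
  exact hi ▸ hM.eigenvalues_pos i

theorem isHermitian_symmetricPart (M : Matrix (Fin n) (Fin n) ℝ) :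
    (symmetricPart M).IsHermitian := by
  ext i j
  simp [symmetricPart, add_comm, mul_add]

theorem dotProduct_symmetricPart_mulVec (M : Matrix (Fin n) (Fin n) ℝ) (v : Fin n → ℝ) :
    v ⬝ᵥ Matrix.mulVec (symmetricPart M) v = v ⬝ᵥ Matrix.mulVec M v := by
  have : v ⬝ᵥ Matrix.mulVec M.transpose v = v ⬝ᵥ Matrix.mulVec M v := by
    rw [Matrix.mulVec_transpose, dotProduct_comm, Matrix.dotProduct_mulVec]
  rw [symmetricPart, Matrix.smul_mulVec, Matrix.add_mulVec, dotProduct_smul, dotProduct_add,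
    this, smul_eq_mul]
  ring

theorem PositiveDefinite.posDef_symmetricPart (hM : PositiveDefinite M) :
    (symmetricPart M).PosDef :=
  .of_dotProduct_mulVec_pos (isHermitian_symmetricPart M) fun {v} hv => by
    simpa [dotProduct_symmetricPart_mulVec] using hM v hv

theorem PositiveDefinite.inner_nonneg (hM : PositiveDefinite M)
    (v : EuclideanSpace ℝ (Fin n)) : 0 ≤ inner ℝ v (Matrix.toEuclideanLin M v) := by
  rw [inner_toEuclideanLin_self, ← dotProduct_symmetricPart_mulVec, ← inner_toEuclideanLin_self]
  exact hM.posDef_symmetricPart.posSemidef.inner_toEuclideanLin_nonneg v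

theorem PositiveDefinite.mul_norm_sq_le (hM : PositiveDefinite M) {b : ℝ} (hb : 0 ≤ b)
    (v : EuclideanSpace ℝ (Fin n)) :
    b * ‖v‖ ^ 2 ≤
      b / lambdaMin (symmetricPart M) * inner ℝ v (Matrix.toEuclideanLin M v) := by
  obtain rfl | hn := eq_or_ne n 0
  · simp [Subsingleton.elim v 0]
  have : NeZero n := ⟨hn⟩
  have hpos := lambdaMin_pos hM.posDef_symmetricPart
  have h := (isHermitian_symmetricPart M).le_inner_toEuclideanLin v
  rw [inner_toEuclideanLin_self, dotProduct_symmetricPart_mulVec,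
    ← inner_toEuclideanLin_self] at h
  calc b * ‖v‖ ^ 2
      = b / lambdaMin (symmetricPart M) * (lambdaMin (symmetricPart M) * ‖v‖ ^ 2) := by
        field_simp
    _ ≤ _ := by gcongr

end QuadraticForms

/-- Diffusive coupling over a symmetric nonnegative weighting is dissipative. -/
theorem sum_inner_coupling_nonpos {ι E : Type*} [Fintype ι] [NormedAddCommGroup E]
    [InnerProductSpace ℝ E] {a : ι → ι → ℝ} (ha : ∀ i j, 0 ≤ a i j)
    (hsymm : ∀ i j, a i j = a j i) {L : E →ₗ[ℝ] E} (hL : ∀ v, 0 ≤ inner ℝ v (L v))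
    (e : ι → E) : ∑ i, inner ℝ (e i) (∑ j, a i j • L (e j - e i)) ≤ 0 := by
  simp only [inner_sum, real_inner_smul_right]
  -- Averaging the sum with its index-swapped form gives `-½ ∑ a_ij ⟪e_j - e_i, L (e_j - e_i)⟫`; `L`
  -- need not be symmetric.
  have hswap : ∑ i, ∑ j, a i j * inner ℝ (e i) (L (e j - e i)) =
      ∑ i, ∑ j, -(a i j * inner ℝ (e j) (L (e j - e i))) := by
    rw [Finset.sum_comm]
    refine Finset.sum_congr rfl fun i _ => Finset.sum_congr rfl fun j _ => ?_
    rw [hsymm j i, ← neg_sub (e j) (e i), map_neg, inner_neg_right, mul_neg]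
  have hsum : ∑ i, ∑ j, a i j * inner ℝ (e i) (L (e j - e i)) +
      ∑ i, ∑ j, -(a i j * inner ℝ (e j) (L (e j - e i))) ≤ 0 := by
    simp only [← Finset.sum_add_distrib]
    refine Finset.sum_nonpos fun i _ => Finset.sum_nonpos fun j _ => ?_
    have := mul_nonneg (ha i j) (hL (e j - e i))
    rw [inner_sub_left, mul_sub] at this
    linarith
  linarith

/-- A differential inequality `V' ≤ -k V` forces exponential decay. -/
theorem le_exp_mul_of_deriv_le {T : Set ℝ} (hT : T.OrdConnected) {t₀ : ℝ} (ht₀ : IsLeast T t₀)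
    {V V' : ℝ → ℝ} {k : ℝ} (hV : ∀ t ∈ T, HasDerivWithinAt V (V' t) T t)
    (hle : ∀ t ∈ T, V' t ≤ -k * V t) {t : ℝ} (ht : t ∈ T) :
    V t ≤ Real.exp (-k * (t - t₀)) * V t₀ := by
  -- Integrating factor: the product is antitone on `T`.
  have hd : ∀ t ∈ T, HasDerivWithinAt (fun t => Real.exp (k * (t - t₀)) * V t)
      (Real.exp (k * (t - t₀)) * k * V t + Real.exp (k * (t - t₀)) * V' t) T t := fun t ht => by
    have h : HasDerivAt (fun t => k * (t - t₀)) k t := by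
      simpa using ((hasDerivAt_id t).sub_const t₀).const_mul k
    exact h.exp.hasDerivWithinAt.mul (hV t ht)
  have hanti : AntitoneOn (fun t => Real.exp (k * (t - t₀)) * V t) T := by
    refine antitoneOn_of_hasDerivWithinAt_nonpos hT.convex
      (fun t ht => (hd t ht).continuousWithinAt)
      (fun t ht => (hd t (interior_subset ht)).mono interior_subset) fun t ht => ?_
    have := mul_le_mul_of_nonneg_left (hle t (interior_subset ht))
      (Real.exp_pos (k * (t - t₀))).le
    linarith
  have h := hanti ht₀.1 ht (ht₀.2 ht)
  simp only [sub_self, mul_zero, Real.exp_zero, one_mul] at h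
  calc V t = Real.exp (-k * (t - t₀)) * (Real.exp (k * (t - t₀)) * V t) := by
        rw [← mul_assoc, ← Real.exp_add]; simp
    _ ≤ _ := by gcongr

/-- The squared tracking error decreases at rate `2 α` along the closed loop with all nodes
pinned. -/
theorem Network.sum_inner_error_le {N n : ℕ} (S : Network N n) (hc : 0 < S.c)
    (hA₀ : ∀ i j, 0 ≤ S.A i j) (hA : ∀ i j, S.A i j = S.A j i)
    {Ω : Set (EuclideanSpace ℝ (Fin n))} {F : Matrix (Fin n) (Fin n) ℝ}
    (hF : F.PosSemidef) (hf : QuadBound S.f Ω F) (hH : PositiveDefinite S.H) {α : ℝ}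
    (hα : 0 < α) {s : EuclideanSpace ℝ (Fin n)} {x : Fin N → EuclideanSpace ℝ (Fin n)}
    (hs : s ∈ Ω) (hx : ∀ i, x i ∈ Ω) :
    ∑ i, inner ℝ (x i - s)
      (S.f (x i) + S.c • ∑ j, S.A i j • Matrix.toEuclideanLin S.H (x j - x i) +
        -(((α + lambdaMax F) / lambdaMin (symmetricPart S.H)) •
          Matrix.toEuclideanLin S.H (x i - s)) - S.f s) ≤ -α * ∑ i, ‖x i - s‖ ^ 2 := by
  have hcoup := sum_inner_coupling_nonpos hA₀ hA (L := Matrix.toEuclideanLin S.H)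
    hH.inner_nonneg (fun i => x i - s)
  -- The reference cancels in `e_j - e_i = x_j - x_i`.
  simp only [sub_sub_sub_cancel_right] at hcoup
  have hnode : ∀ i, inner ℝ (x i - s)
      (S.f (x i) + S.c • ∑ j, S.A i j • Matrix.toEuclideanLin S.H (x j - x i) +
        -(((α + lambdaMax F) / lambdaMin (symmetricPart S.H)) •
          Matrix.toEuclideanLin S.H (x i - s)) - S.f s) ≤
      -α * ‖x i - s‖ ^ 2 + S.c * inner ℝ (x i - s)
        (∑ j, S.A i j • Matrix.toEuclideanLin S.H (x j - x i)) := fun i => by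
    have h₁ := (hf _ (hx i) _ hs).trans (hF.isHermitian.inner_toEuclideanLin_le _)
    have h₂ := hH.mul_norm_sq_le (add_nonneg hα.le (lambdaMax_nonneg hF)) (x i - s)
    rw [inner_sub_right] at h₁
    rw [inner_sub_right, inner_add_right, inner_add_right, inner_neg_right,
      real_inner_smul_right, real_inner_smul_right]
    linarith
  refine (Finset.sum_le_sum fun i _ => hnode i).trans ?_
  rw [Finset.sum_add_distrib, ← Finset.mul_sum, ← Finset.mul_sum]
  linarith [mul_nonpos_of_nonneg_of_nonpos hc.le hcoup]

theorem norm_trackingError_sq {N n : ℕ} (s : ℝ → EuclideanSpace ℝ (Fin n))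
    (x : Fin N → ℝ → EuclideanSpace ℝ (Fin n)) (t : ℝ) :
    ‖trackingError s x t‖ ^ 2 = ∑ i, ‖x i t - s t‖ ^ 2 :=
  PiLp.norm_sq_eq_of_L2 _ _

theorem mainTheorem5 {N n : ℕ} (S : Network N n) (hc : 0 < S.c)
    (hA : UndirectedConnected S.A)
    (Ω : Set (EuclideanSpace ℝ (Fin n))) (F : Matrix (Fin n) (Fin n) ℝ)
    (hF : F.PosSemidef) (hf : QuadBound S.f Ω F)
    (hH : PositiveDefinite S.H) (α : ℝ) (hα : 0 < α) :
    ∃ P : PinningPair N,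
      P.Z = 1 ∧
      P.G = ((α + lambdaMax F) / lambdaMin (symmetricPart S.H)) •
        (1 : Matrix (Fin N) (Fin N) ℝ) ∧
      S.GuaranteesRate Ω P α := by
  refine ⟨⟨fun _ => 1, fun _ => .inr rfl,
    fun _ => (α + lambdaMax F) / lambdaMin (symmetricPart S.H)⟩, Matrix.diagonal_one,
    (Matrix.smul_one_eq_diagonal _).symm, 1, ?_⟩
  intro t₀ T hT ht₀ s x hΩ hs hx t ht
  have hV : ∀ t ∈ T, HasDerivWithinAt (fun t => ∑ i, ‖x i t - s t‖ ^ 2) _ T t := fun t ht =>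
    HasDerivWithinAt.fun_sum fun i _ => ((hx i t ht).sub (hs t ht)).norm_sq
  have h := le_exp_mul_of_deriv_le hT ht₀ (k := 2 * α) hV (fun t ht => by
    have := S.sum_inner_error_le hc hA.1 hA.2.1 hF hf hH hα (hΩ t ht).1 (hΩ t ht).2
    simp only [Network.feedback, one_mul, Pi.sub_apply, ← Finset.mul_sum]
    linarith) ht
  simp only [← norm_trackingError_sq] at h
  rw [one_mul]
  -- Rate `2α` for the squared norm is rate `α` for the norm.
  refine (sq_le_sq₀ (norm_nonneg _) (by positivity)).1 ?_
  have hexp : Real.exp (-α * (t - t₀)) ^ 2 = Real.exp (-(2 * α) * (t - t₀)) := by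
    rw [← Real.exp_nat_mul]
    congr 1
    push_cast
    ring
  rwa [mul_pow, hexp]
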